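/- Let $\mathbb{Q}_2=\{a/2^b\le 1 : a,b\in\omega\}$ be the set of dyadic rationals in $[0,1]$, coded in the usual way by pairs $(a,b)$ of natural numbers. For $x\in 2^\omega$ let $\mathrm{val}(x)=\sum_{i\in\omega}x(i)2^{-(i+1)}\in[0,1]$, and for $q\in\mathbb{Q}_2$ write $q<x$ if $q<\mathrm{val}(x)$. A real $x\in2^\omega$ is \emph{left-c.e.} if $\{q\in\mathbb{Q}_2: q<x\}$ is computably enumerable (c.e.). An \emph{effective numbering} of a family $\mathcal{R}$ of left-c.e. reals is a map $r:\omega\to 2^\omega$ with range exactly $\mathcal{R}$ such that $\{(q,e)\in\mathbb{Q}_2\times\omega: q<r(e)\}$ is c.e.; it is a \emph{Friedberg numbering} of $\mathcal{R}$ if moreover $r$ is injective. Theorem. The family of all left-c.e. reals has a Friedberg numbering. The same holds when reals with the same value are identified: there is an injective map $v:\omega\to\mathbb{R}$ with range $\{\mathrm{val}(x): x\in 2^\omega \text{ is left-c.e.}\}$ such that $\{(q,e)\in\mathbb{Q}_2\times\omega: q<v(e)\}$ is c.e. -/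

import Mathlib

/-- Infinite binary sequences, the points of Cantor space. -/
abbrev CantorSpace : Type := ℕ → Fin 2

/-- The real number `∑ i, x i * 2 ^ (-(i + 1))` with binary expansion `x`. -/
noncomputable def CantorSpace.value (x : CantorSpace) : ℝ := Real.ofDigits x

/-- The dyadic rationals `a / 2 ^ b ≤ 1` with natural numbers `a` and `b`. -/
def dyadicRationals : Set ℚ := {q | (∃ a b : ℕ, q = (a : ℚ) / 2 ^ b) ∧ q ≤ 1}

/-- Computable enumerability of a set of dyadic rationals, where the pair `(a, b)` is a code of
`a / 2 ^ b`: the set of all codes of its members is c.e. -/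
def IsCEDyadic (S : Set ℚ) : Prop :=
  S ⊆ dyadicRationals ∧ REPred fun p : ℕ × ℕ => (p.1 : ℚ) / 2 ^ p.2 ∈ S

/-- Computable enumerability of a set of pairs of a dyadic rational and a natural number,
with the same codes of dyadic rationals. -/
def IsCEDyadicNat (S : Set (ℚ × ℕ)) : Prop :=
  (∀ p ∈ S, p.1 ∈ dyadicRationals) ∧
    REPred fun p : (ℕ × ℕ) × ℕ => ((p.1.1 : ℚ) / 2 ^ p.1.2, p.2) ∈ S

/-- A sequence is left-c.e. if the set of dyadic rationals `q < x` is c.e. -/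
def IsLeftCE (x : CantorSpace) : Prop :=
  IsCEDyadic {q | q ∈ dyadicRationals ∧ (q : ℝ) < x.value}

/-- `r` is an effective numbering of the family `R`. -/
structure IsEffectiveNumbering (R : Set CantorSpace) (r : ℕ → CantorSpace) : Prop where
  range_eq : Set.range r = R
  ce : IsCEDyadicNat {p | p.1 ∈ dyadicRationals ∧ (p.1 : ℝ) < (r p.2).value}

/-- A Friedberg numbering is an injective effective numbering. -/
structure IsFriedbergNumbering (R : Set CantorSpace) (r : ℕ → CantorSpace) : Prop
    extends IsEffectiveNumbering R r where
  injective : Function.Injective r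

/-! Reals are handled through primitive recursive sequences `F s` for which `F s / 2 ^ s` stays
below the limit and tends to it; monotonicity is not required, so an approximation may change its
target as long as it never exceeds the final value.

The core is a Friedberg argument (`exists_injective_isLeftCESeq`). The family is split into a
sequence `y` with repetitions and a strictly increasing reserve `b` disjoint from it. Every `y j`
has followers. Whenever `y j` looks equal to an earlier `y i` to a new precision, its follower is
replaced and the old one is released to a reserve real; this is possible because the reserve reals
lie above everything the follower has approximated. If `y j` repeats an earlier value, there are
infinitely many replacements and no follower survives; if `y j` is the first occurrence of its
value, there are finitely many and the last follower is permanent. With `T` the last replacement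
stage, index `⟨j, t⟩` has value `b ⟨j, t⟩` for `t < T`, `y j` for `t = T`, and `b ⟨j, t - 1⟩` for `t
> T`. Without a last stage the value is always `b ⟨j, t⟩`. In both cases every `b ⟨j, ·⟩` is used
exactly once.

The reserve consists of the numbers `1 - 2 ^ (-(m + 1))`. To avoid it effectively, a universal
sequence of left-c.e. reals is clamped into closed subintervals of the gaps between consecutive
numbers `1 - 2 ^ (-k)`. Clamping adds only dyadic rationals, and the endpoints `0` and `1` are
adjoined by hand.

In Cantor space only the dyadic rationals in `(0, 1)` have two expansions. Nonterminating expansions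
of all left-c.e. values are interleaved with terminating expansions of those dyadics, the latter
enumerated injectively by the same construction. -/

open Filter Topology

/-! ### Approximations from below and uniformly left-c.e. sequences. -/

/-- The numbers `F s / 2 ^ s` are lower bounds of `u` and converge to `u`. -/
structure IsApprox (F : ℕ → ℕ) (u : ℝ) : Prop where
  le : ∀ s, (F s : ℝ) / 2 ^ s ≤ u
  tendsto : Tendsto (fun s => (F s : ℝ) / 2 ^ s) atTop (𝓝 u)

/-- A uniformly left-c.e. sequence of nonnegative reals. -/
def IsLeftCESeq (v : ℕ → ℝ) : Prop :=
  ∃ F : ℕ → ℕ → ℕ, Primrec₂ F ∧ ∀ e, IsApprox (F e) (v e)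

/-- The lower bound property gives one direction and convergence the other. This is what turns an
approximation into an enumeration of the left cut. -/
theorem IsApprox.lt_iff {F : ℕ → ℕ} {u q : ℝ} (h : IsApprox F u) :
    q < u ↔ ∃ s, q < (F s : ℝ) / 2 ^ s :=
  ⟨fun hq => (h.tendsto.eventually (lt_mem_nhds hq)).exists,
    fun ⟨s, hs⟩ => hs.trans_le (h.le s)⟩

theorem IsApprox.nonneg {F : ℕ → ℕ} {u : ℝ} (h : IsApprox F u) : 0 ≤ u :=
  le_trans (by positivity) (h.le 0)

theorem IsApprox.min {F G : ℕ → ℕ} {u v : ℝ} (hF : IsApprox F u) (hG : IsApprox G v) :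
    IsApprox (fun s => min (F s) (G s)) (min u v) := by
  have key : ∀ s, ((Min.min (F s) (G s) : ℕ) : ℝ) / 2 ^ s =
      Min.min ((F s : ℝ) / 2 ^ s) ((G s : ℝ) / 2 ^ s) := fun s => by
    rw [Nat.cast_min, min_div_div_right (by positivity)]
  refine ⟨fun s => ?_, ?_⟩
  · rw [key]; exact min_le_min (hF.le s) (hG.le s)
  · simp only [key]; exact hF.tendsto.min hG.tendsto

theorem IsApprox.max {F G : ℕ → ℕ} {u v : ℝ} (hF : IsApprox F u) (hG : IsApprox G v) :
    IsApprox (fun s => max (F s) (G s)) (max u v) := by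
  have key : ∀ s, ((Max.max (F s) (G s) : ℕ) : ℝ) / 2 ^ s =
      Max.max ((F s : ℝ) / 2 ^ s) ((G s : ℝ) / 2 ^ s) := fun s => by
    rw [Nat.cast_max, max_div_div_right (by positivity)]
  refine ⟨fun s => ?_, ?_⟩
  · rw [key]; exact max_le_max (hF.le s) (hG.le s)
  · simp only [key]; exact hF.tendsto.max hG.tendsto

/-- The standard approximation of the dyadic rational `p / 2 ^ N`. -/
def dyadicApprox (p N s : ℕ) : ℕ := p * 2 ^ s / 2 ^ N

theorem isApprox_dyadicApprox (p N : ℕ) : IsApprox (dyadicApprox p N) ((p : ℝ) / 2 ^ N) := by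
  have key : ∀ s, dyadicApprox p N s = ⌊(p : ℝ) / 2 ^ N * 2 ^ s⌋₊ := fun s => by
    rw [dyadicApprox, div_mul_eq_mul_div]
    exact_mod_cast (Nat.floor_div_eq_div (K := ℝ) (p * 2 ^ s) (2 ^ N)).symm
  refine ⟨fun s => ?_, ?_⟩
  · rw [key, div_le_iff₀ (by positivity)]
    exact Nat.floor_le (by positivity)
  · simp only [key]
    exact (tendsto_nat_floor_mul_div_atTop (R := ℝ) (a := (p : ℝ) / 2 ^ N) (by positivity)).comp
      (tendsto_pow_atTop_atTop_of_one_lt one_lt_two)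

theorem primrec_nat_pow : Primrec₂ ((· ^ ·) : ℕ → ℕ → ℕ) :=
  Primrec₂.unpaired'.1 Nat.Primrec.pow

theorem primrec_two_pow {α : Type*} [Primcodable α] {f : α → ℕ} (hf : Primrec f) :
    Primrec fun a => 2 ^ f a :=
  primrec_nat_pow.comp (Primrec.const 2) hf

theorem primrec_dyadicApprox {α : Type*} [Primcodable α] {f g h : α → ℕ} (hf : Primrec f)
    (hg : Primrec g) (hh : Primrec h) : Primrec fun a => dyadicApprox (f a) (g a) (h a) :=
  Primrec.nat_div.comp (Primrec.nat_mul.comp hf (primrec_two_pow hh)) (primrec_two_pow hg)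

theorem IsLeftCESeq.cons {v : ℕ → ℝ} (hv : IsLeftCESeq v) (p N : ℕ) :
    IsLeftCESeq fun n => Nat.casesOn n ((p : ℝ) / 2 ^ N) v := by
  obtain ⟨F, hF, hFv⟩ := hv
  refine ⟨fun e s => Nat.casesOn e (dyadicApprox p N s) fun e' => F e' s, ?_, ?_⟩
  · refine Primrec.nat_casesOn Primrec.fst
      (primrec_dyadicApprox (Primrec.const p) (Primrec.const N) Primrec.snd) ?_
    exact (hF.comp Primrec.snd (Primrec.snd.comp Primrec.fst)).to₂
  · rintro (_ | e)
    · exact isApprox_dyadicApprox p N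
    · exact hFv e

theorem REPred.comp {α β : Type*} [Primcodable α] [Primcodable β] {p : β → Prop} (hp : REPred p)
    {f : α → β} (hf : Computable f) : REPred fun a => p (f a) :=
  Partrec.comp hp hf

theorem REPred.of_exists {α : Type*} [Primcodable α] {R : α → ℕ → Prop} (hR : PrimrecRel R) :
    REPred fun a => ∃ n, R a n := by
  classical
  have h : Partrec fun a => Nat.rfind fun n => Part.some (decide (R a n)) :=
    Partrec.rfind (Primrec.to_comp hR.decide).partrec
  refine h.dom_re.of_eq fun a => ?_
  refine Nat.rfind_dom.trans ?_
  simp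

/-- The real `u` is left-c.e. -/
def IsLeftCEReal (u : ℝ) : Prop := REPred fun p : ℕ × ℕ => (p.1 : ℝ) / 2 ^ p.2 < u

theorem IsLeftCESeq.rePred {v : ℕ → ℝ} (hv : IsLeftCESeq v) :
    REPred fun p : (ℕ × ℕ) × ℕ => (p.1.1 : ℝ) / 2 ^ p.1.2 < v p.2 := by
  obtain ⟨F, hF, hFv⟩ := hv
  have hR : PrimrecRel fun (p : (ℕ × ℕ) × ℕ) s => p.1.1 * 2 ^ s < F p.2 s * 2 ^ p.1.2 := by
    refine Primrec.nat_lt.comp (Primrec.nat_mul.comp ?_ (primrec_two_pow Primrec.snd))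
      (Primrec.nat_mul.comp (hF.comp (Primrec.snd.comp Primrec.fst) Primrec.snd)
        (primrec_two_pow ?_))
    · exact Primrec.fst.comp (Primrec.fst.comp Primrec.fst)
    · exact Primrec.snd.comp (Primrec.fst.comp Primrec.fst)
  refine (REPred.of_exists hR).of_eq fun p => ?_
  rw [(hFv p.2).lt_iff]
  refine exists_congr fun s => ?_
  rw [div_lt_div_iff₀ (by positivity) (by positivity)]
  norm_cast

theorem IsLeftCESeq.isLeftCEReal {v : ℕ → ℝ} (hv : IsLeftCESeq v) (e : ℕ) : IsLeftCEReal (v e) :=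
  REPred.comp (α := ℕ × ℕ) (f := fun p => (p, e)) hv.rePred
    (Computable.pair Computable.id (Computable.const e))

theorem mem_dyadicRationals_and_lt_iff {u : ℝ} (hu : u ≤ 1) (a b : ℕ) :
    (a : ℚ) / 2 ^ b ∈ dyadicRationals ∧ (((a : ℚ) / 2 ^ b : ℚ) : ℝ) < u ↔
      (a : ℝ) / 2 ^ b < u := by
  push_cast
  refine ⟨And.right, fun h => ⟨⟨⟨a, b, rfl⟩, ?_⟩, h⟩⟩
  have : (((a : ℚ) / 2 ^ b : ℚ) : ℝ) ≤ ((1 : ℚ) : ℝ) := by push_cast; linarith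
  exact_mod_cast this

theorem isLeftCE_iff (x : CantorSpace) : IsLeftCE x ↔ IsLeftCEReal x.value := by
  have h : ∀ p : ℕ × ℕ, (p.1 : ℚ) / 2 ^ p.2 ∈ {q : ℚ | q ∈ dyadicRationals ∧ (q : ℝ) < x.value} ↔
      (p.1 : ℝ) / 2 ^ p.2 < x.value := fun p =>
    mem_dyadicRationals_and_lt_iff (Real.ofDigits_le_one x) p.1 p.2
  exact ⟨fun hx => hx.2.of_eq h, fun hx => ⟨fun q hq => hq.1, REPred.of_eq hx fun p => (h p).symm⟩⟩

theorem IsLeftCESeq.isCEDyadicNat {v : ℕ → ℝ} (hv : IsLeftCESeq v) (h1 : ∀ e, v e ≤ 1) :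
    IsCEDyadicNat {p | p.1 ∈ dyadicRationals ∧ (p.1 : ℝ) < v p.2} :=
  ⟨fun _ hp => hp.1, hv.rePred.of_eq fun p =>
    (mem_dyadicRationals_and_lt_iff (h1 p.2) p.1.1 p.1.2).symm⟩

/-! ### A universal uniformly left-c.e. sequence in `[0, 1]`. -/

open Nat.Partrec (Code)

open Nat.Partrec.Code in
/-- The dyadic rational, in units of `2 ^ (-(s + 1))`, enumerated by the program with index `c` at
stage `s`. -/
def enumeratedDyadic (c s : ℕ) : ℕ :=
  if (evaln s.unpair.2 (Denumerable.ofNat Code c) s.unpair.1).isSome = true then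
    min (2 ^ (s + 1)) (dyadicApprox s.unpair.1.unpair.1 s.unpair.1.unpair.2 (s + 1)) else 0

/-- The stage-`s` approximation, in units of `2 ^ (-s)`, of the supremum of the dyadic rationals
enumerated by the program with index `c`. -/
def universalApprox (c s : ℕ) : ℕ :=
  Nat.rec 0 (fun s X => max (2 * X) (enumeratedDyadic c s)) s

theorem universalApprox_succ (c s : ℕ) : universalApprox c (s + 1) =
    max (2 * universalApprox c s) (enumeratedDyadic c s) := rfl

theorem primrec_enumeratedDyadic : Primrec₂ enumeratedDyadic := by
  have hs : Primrec fun q : ℕ × ℕ => q.2 := Primrec.snd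
  have hm : Primrec fun q : ℕ × ℕ => q.2.unpair.1 := Primrec.fst.comp (Primrec.unpair.comp hs)
  have hk : Primrec fun q : ℕ × ℕ => q.2.unpair.2 := Primrec.snd.comp (Primrec.unpair.comp hs)
  have ha : Primrec fun q : ℕ × ℕ => q.2.unpair.1.unpair.1 :=
    Primrec.fst.comp (Primrec.unpair.comp hm)
  have hb : Primrec fun q : ℕ × ℕ => q.2.unpair.1.unpair.2 :=
    Primrec.snd.comp (Primrec.unpair.comp hm)
  have hc : Primrec fun q : ℕ × ℕ => Denumerable.ofNat Code q.1 :=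
    (Primrec.ofNat Code).comp Primrec.fst
  refine Primrec.ite ?_ ?_ (Primrec.const 0)
  · exact Primrec.eq.comp (Primrec.option_isSome.comp
      (Nat.Partrec.Code.primrec_evaln.comp (Primrec.pair (Primrec.pair hk hc) hm)))
      (Primrec.const true)
  · exact Primrec.nat_min.comp (primrec_two_pow (Primrec.succ.comp hs))
      (primrec_dyadicApprox ha hb (Primrec.succ.comp hs))

theorem primrec_universalApprox : Primrec₂ universalApprox := by
  have h : Primrec₂ fun (p : ℕ × ℕ) (q : ℕ × ℕ) => max (2 * q.2) (enumeratedDyadic p.1 q.1) :=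
    Primrec.nat_max.comp
      (Primrec.nat_mul.comp (Primrec.const 2) (Primrec.snd.comp Primrec.snd))
      (primrec_enumeratedDyadic.comp (Primrec.fst.comp Primrec.fst) (Primrec.fst.comp Primrec.snd))
  exact Primrec.nat_rec' Primrec.snd (Primrec.const 0) h

theorem universalApprox_le (c s : ℕ) : universalApprox c s ≤ 2 ^ s := by
  induction s with
  | zero => exact Nat.zero_le _
  | succ s ih =>
    refine max_le (by rw [pow_succ']; exact Nat.mul_le_mul_left 2 ih) ?_
    unfold enumeratedDyadic
    split_ifs
    · exact min_le_left _ _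
    · exact Nat.zero_le _

theorem monotone_universalApprox (c : ℕ) :
    Monotone fun s => (universalApprox c s : ℝ) / 2 ^ s := by
  refine monotone_nat_of_le_succ fun s => ?_
  have h : 2 * universalApprox c s ≤ universalApprox c (s + 1) := le_max_left _ _
  rw [div_le_div_iff₀ (by positivity) (by positivity), pow_succ', ← mul_assoc]
  gcongr
  rw [mul_comm]
  exact_mod_cast h

theorem bddAbove_universalApprox (c : ℕ) :
    BddAbove (Set.range fun s => (universalApprox c s : ℝ) / 2 ^ s) := by
  refine ⟨1, ?_⟩
  rintro _ ⟨s, rfl⟩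
  rw [div_le_one (by positivity)]
  exact_mod_cast universalApprox_le c s

/-- The left-c.e. real in `[0, 1]` with index `c`. -/
noncomputable def universalReal (c : ℕ) : ℝ := ⨆ s, (universalApprox c s : ℝ) / 2 ^ s

theorem isApprox_universalReal (c : ℕ) : IsApprox (universalApprox c) (universalReal c) :=
  ⟨fun s => le_ciSup (bddAbove_universalApprox c) s,
    tendsto_atTop_ciSup (monotone_universalApprox c) (bddAbove_universalApprox c)⟩

theorem exists_dyadic_between {q u : ℝ} (hq : 0 ≤ q) (h : q < u) :
    ∃ a b : ℕ, q < (a : ℝ) / 2 ^ b ∧ (a : ℝ) / 2 ^ b < u := by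
  obtain ⟨u', hu', hu'u⟩ := exists_between h
  have := (tendsto_nat_floor_mul_div_atTop (R := ℝ) (a := u') (hq.trans hu'.le)).comp
    (tendsto_pow_atTop_atTop_of_one_lt (one_lt_two (α := ℝ)))
  obtain ⟨b, hb⟩ := ((this.eventually (lt_mem_nhds hu')).and
    (this.eventually (gt_mem_nhds hu'u))).exists
  exact ⟨_, b, hb.1, hb.2⟩

-- The index `c` is a program halting exactly on the codes of dyadics below `u`; the supremum of
-- these dyadics is `u`.
open Nat.Partrec.Code in
theorem exists_universalReal_eq {u : ℝ} (h0 : 0 < u) (h1 : u ≤ 1) (hu : IsLeftCEReal u) :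
    ∃ c, universalReal c = u := by
  have hu' : REPred fun m : ℕ => (m.unpair.1 : ℝ) / 2 ^ m.unpair.2 < u :=
    REPred.comp hu Primrec.unpair.to_comp
  have hpart : Nat.Partrec fun m : ℕ => (Part.assert ((m.unpair.1 : ℝ) / 2 ^ m.unpair.2 < u)
      fun _ => Part.some 0) :=
    Partrec.nat_iff.1 ((Partrec.map hu' (Computable.const 0).to₂).of_eq fun m => by
      ext; simp [eq_comm])
  obtain ⟨c, hc⟩ := exists_code.1 hpart
  have hdom : ∀ m : ℕ, (m.unpair.1 : ℝ) / 2 ^ m.unpair.2 < u ↔ ∃ k, (evaln k c m).isSome := by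
    intro m
    have : (m.unpair.1 : ℝ) / 2 ^ m.unpair.2 < u ↔ 0 ∈ eval c m := by rw [hc]; simp
    rw [this, evaln_complete]
    refine exists_congr fun k => ⟨fun h => Option.isSome_iff_exists.2 ⟨0, h⟩, fun h => ?_⟩
    obtain ⟨z, hz⟩ := Option.isSome_iff_exists.1 h
    have := evaln_sound (Option.mem_def.2 hz)
    rw [hc] at this
    obtain rfl : z = 0 := by
      obtain ⟨_, h'⟩ := Part.mem_assert_iff.1 this
      exact Part.mem_some_iff.1 h'
    exact hz
  refine ⟨Encodable.encode c, ?_⟩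
  have hcode : Denumerable.ofNat Code (Encodable.encode c) = c := Denumerable.ofNat_encode c
  refine le_antisymm (ciSup_le fun s => ?_) (le_of_forall_lt_imp_le_of_dense fun q hq => ?_)
  · induction s with
    | zero => simpa [universalApprox] using h0.le
    | succ s ih =>
      rw [div_le_iff₀ (by positivity)] at ih ⊢
      rw [universalApprox_succ, enumeratedDyadic, hcode, Nat.cast_max, max_le_iff]
      constructor
      · push_cast; rw [pow_succ]; linarith
      · split_ifs with hs
        · refine le_trans (Nat.cast_le.2 (min_le_right _ _)) ?_
          rw [← div_le_iff₀ (by positivity)]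
          exact ((isApprox_dyadicApprox _ _).le _).trans ((hdom _).2 ⟨_, hs⟩).le
        · push_cast; positivity
  · rcases lt_or_ge q 0 with hq0 | hq0
    · exact hq0.le.trans (isApprox_universalReal _).nonneg
    obtain ⟨a, b, hqa, hau⟩ := exists_dyadic_between hq0 hq
    obtain ⟨k, hk⟩ := (hdom (Nat.pair a b)).1 (by simpa using hau)
    refine hqa.le.trans (le_trans ?_
      ((isApprox_universalReal (Encodable.encode c)).le (Nat.pair (Nat.pair a b) k + 1)))
    -- The stage codes both the input and the step bound, so it is at least `b`, and `dyadicApprox`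
    -- represents `a / 2 ^ b` without rounding.
    have hb : b ≤ Nat.pair (Nat.pair a b) k + 1 :=
      ((Nat.right_le_pair a b).trans (Nat.left_le_pair _ _)).trans (Nat.le_succ _)
    rw [universalApprox_succ, enumeratedDyadic, hcode, le_div_iff₀ (by positivity),
      Nat.unpair_pair, if_pos hk, Nat.unpair_pair]
    obtain ⟨d, hd⟩ := Nat.exists_eq_add_of_le hb
    have hval : dyadicApprox a b (Nat.pair (Nat.pair a b) k + 1) = a * 2 ^ d := by
      rw [hd, dyadicApprox, pow_add, mul_left_comm, Nat.mul_div_cancel_left _ (by positivity)]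
    have hval' : (a : ℝ) / 2 ^ b * 2 ^ (Nat.pair (Nat.pair a b) k + 1) = a * 2 ^ d := by
      rw [hd, pow_add]; field_simp
    refine le_trans ?_ (Nat.cast_le.2 (le_max_right _ _))
    rw [Nat.cast_min, le_min_iff]
    constructor
    · push_cast
      exact mul_le_of_le_one_left (by positivity) (hau.le.trans h1)
    · simp only
      rw [hval, hval']; push_cast; rfl

theorem PrimrecRel.bounded_exists {β : Type*} [Primcodable β] {R : ℕ → β → Prop}
    (hR : PrimrecRel R) {f : β → ℕ} (hf : Primrec f) : PrimrecPred fun y => ∃ x < f y, R x y :=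
  (hR.exists_mem_list.comp (Primrec.list_range.comp hf) Primrec.id).of_eq fun y => by simp

theorem PrimrecRel.bounded_forall {β : Type*} [Primcodable β] {R : ℕ → β → Prop}
    (hR : PrimrecRel R) {f : β → ℕ} (hf : Primrec f) : PrimrecPred fun y => ∀ x < f y, R x y :=
  (hR.forall_mem_list.comp (Primrec.list_range.comp hf) Primrec.id).of_eq fun y => by simp

/-! ### The construction with followers and a reserve. -/

section Friedberg

/-- At stage `s`, the `j`-th approximation is `2 ^ (-n)`-close to an earlier one. -/
def CloseToEarlier (Y : ℕ → ℕ → ℕ) (j n s : ℕ) : Prop :=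
  ∃ i < j, Y j s * 2 ^ n ≤ Y i s * 2 ^ n + 2 ^ s ∧ Y i s * 2 ^ n ≤ Y j s * 2 ^ n + 2 ^ s

/-- At stage `s`, the follower of the `j`-th real is replaced: `s` is the first stage from `n` on
at which the `j`-th approximation is `2 ^ (-n)`-close to an earlier one, for some `n ≤ s`. -/
def IsReplaced (Y : ℕ → ℕ → ℕ) (j s : ℕ) : Prop :=
  s = 0 ∨ ∃ n < s + 1, CloseToEarlier Y j n s ∧ ∀ r < s, ¬ (n ≤ r ∧ CloseToEarlier Y j n r)

theorem primrecPred_closeToEarlier {Y : ℕ → ℕ → ℕ} (hY : Primrec₂ Y) :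
    PrimrecPred fun p : ℕ × ℕ × ℕ => CloseToEarlier Y p.1 p.2.1 p.2.2 := by
  have hj : Primrec fun q : ℕ × ℕ × ℕ × ℕ => q.2.1 := Primrec.fst.comp Primrec.snd
  have hn : Primrec fun q : ℕ × ℕ × ℕ × ℕ => q.2.2.1 :=
    Primrec.fst.comp (Primrec.snd.comp Primrec.snd)
  have hs : Primrec fun q : ℕ × ℕ × ℕ × ℕ => q.2.2.2 :=
    Primrec.snd.comp (Primrec.snd.comp Primrec.snd)
  have h1 := Primrec.nat_mul.comp (hY.comp hj hs) (primrec_two_pow hn)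
  have h2 := Primrec.nat_mul.comp (hY.comp Primrec.fst hs) (primrec_two_pow hn)
  have h3 := primrec_two_pow hs
  have hR : PrimrecRel fun (i : ℕ) (p : ℕ × ℕ × ℕ) =>
      Y p.1 p.2.2 * 2 ^ p.2.1 ≤ Y i p.2.2 * 2 ^ p.2.1 + 2 ^ p.2.2 ∧
        Y i p.2.2 * 2 ^ p.2.1 ≤ Y p.1 p.2.2 * 2 ^ p.2.1 + 2 ^ p.2.2 :=
    PrimrecPred.and (Primrec.nat_le.comp h1 (Primrec.nat_add.comp h2 h3))
      (Primrec.nat_le.comp h2 (Primrec.nat_add.comp h1 h3))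
  exact hR.bounded_exists Primrec.fst

theorem primrecRel_isReplaced {Y : ℕ → ℕ → ℕ} (hY : Primrec₂ Y) : PrimrecRel (IsReplaced Y) := by
  have hC := primrecPred_closeToEarlier hY
  have hR : PrimrecRel fun (r : ℕ) (q : ℕ × ℕ × ℕ) =>
      ¬ (q.1 ≤ r ∧ CloseToEarlier Y q.2.1 q.1 r) := by
    have h : PrimrecPred fun q : ℕ × ℕ × ℕ × ℕ => CloseToEarlier Y q.2.2.1 q.2.1 q.1 :=
      hC.comp (Primrec.pair (Primrec.fst.comp (Primrec.snd.comp Primrec.snd))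
        (Primrec.pair (Primrec.fst.comp Primrec.snd) Primrec.fst))
    exact PrimrecPred.not (PrimrecPred.and
      (Primrec.nat_le.comp (Primrec.fst.comp Primrec.snd) Primrec.fst) h)
  have hR' : PrimrecPred fun q : ℕ × ℕ × ℕ =>
      ∀ r < q.2.2, ¬ (q.1 ≤ r ∧ CloseToEarlier Y q.2.1 q.1 r) :=
    hR.bounded_forall (Primrec.snd.comp Primrec.snd)
  have hR2 : PrimrecRel fun (n : ℕ) (p : ℕ × ℕ) => CloseToEarlier Y p.1 n p.2 ∧
      ∀ r < p.2, ¬ (n ≤ r ∧ CloseToEarlier Y p.1 n r) := by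
    have h : PrimrecPred fun q : ℕ × ℕ × ℕ => CloseToEarlier Y q.2.1 q.1 q.2.2 :=
      hC.comp (Primrec.pair (Primrec.fst.comp Primrec.snd)
        (Primrec.pair Primrec.fst (Primrec.snd.comp Primrec.snd)))
    exact PrimrecPred.and h hR'
  exact PrimrecPred.or (Primrec.eq.comp Primrec.snd (Primrec.const 0))
    (hR2.bounded_exists (Primrec.succ.comp Primrec.snd))

variable {Y : ℕ → ℕ → ℕ} {y : ℕ → ℝ}

theorem closeToEarlier_iff (j n s : ℕ) : CloseToEarlier Y j n s ↔
    ∃ i < j, |(Y j s : ℝ) / 2 ^ s - (Y i s : ℝ) / 2 ^ s| ≤ 1 / 2 ^ n := by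
  have key : ∀ A B : ℕ, A * 2 ^ n ≤ B * 2 ^ n + 2 ^ s ↔
      (A : ℝ) / 2 ^ s - (B : ℝ) / 2 ^ s ≤ 1 / 2 ^ n := fun A B => by
    rw [← sub_div, div_le_div_iff₀ (by positivity) (by positivity), sub_mul,
      sub_le_iff_le_add, one_mul, add_comm]
    norm_cast
  refine exists_congr fun i => and_congr_right fun _ => ?_
  rw [key, key, abs_le', neg_sub]

/-- The two approximations are eventually within `2 ^ (-(n + 1))`, and the first such stage from `n
+ 1` on is a replacement stage beyond `n`. -/
theorem infinite_isReplaced (hY : ∀ j, IsApprox (Y j) (y j)) {i j : ℕ} (hij : i < j)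
    (h : y i = y j) : {s | IsReplaced Y j s}.Infinite := by
  classical
  refine Set.infinite_of_forall_exists_gt fun n => ?_
  have hlim : Tendsto (fun s => |(Y j s : ℝ) / 2 ^ s - (Y i s : ℝ) / 2 ^ s|) atTop (𝓝 0) := by
    simpa [h] using ((hY j).tendsto.sub (hY i).tendsto).abs
  have hev : ∀ᶠ s in atTop, CloseToEarlier Y j (n + 1) s :=
    (hlim.eventually (ge_mem_nhds (by positivity : (0 : ℝ) < 1 / 2 ^ (n + 1)))).mono
      fun s hs => (closeToEarlier_iff j (n + 1) s).2 ⟨i, hij, hs⟩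
  have hex : ∃ s, n + 1 ≤ s ∧ CloseToEarlier Y j (n + 1) s :=
    ((eventually_ge_atTop (n + 1)).and hev).exists
  obtain ⟨h1, h2⟩ := Nat.find_spec hex
  exact ⟨Nat.find hex, Or.inr ⟨n + 1, Nat.lt_succ_of_le h1, h2, fun r hr => Nat.find_min hex hr⟩, h1⟩

/-- The distances to the earlier limits are positive, so precisions `n ≥ N` never trigger a
replacement at late stages. Each `n < N` triggers at most one, since a first stage is unique. -/
theorem finite_isReplaced (hY : ∀ j, IsApprox (Y j) (y j)) {j : ℕ} (h : ∀ i < j, y i ≠ y j) :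
    {s | IsReplaced Y j s}.Finite := by
  have hev : ∀ᶠ n in atTop, ∀ i < j, (1 : ℝ) / 2 ^ n < |y j - y i| := by
    refine (Set.finite_lt_nat j).eventually_all.2 fun i hi => ?_
    have : Tendsto (fun n : ℕ => (1 : ℝ) / 2 ^ n) atTop (𝓝 0) := by
      simpa using tendsto_pow_atTop_nhds_zero_of_lt_one (r := (1 / 2 : ℝ)) (by norm_num)
        (by norm_num)
    exact this.eventually (gt_mem_nhds (abs_pos.2 (sub_ne_zero.2 (h i hi).symm)))
  obtain ⟨N, hN⟩ := hev.exists
  have hev2 : ∀ᶠ s in atTop, ∀ i < j,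
      (1 : ℝ) / 2 ^ N < |(Y j s : ℝ) / 2 ^ s - (Y i s : ℝ) / 2 ^ s| :=
    (Set.finite_lt_nat j).eventually_all.2 fun i hi =>
      (((hY j).tendsto.sub (hY i).tendsto).abs).eventually (lt_mem_nhds (hN i hi))
  obtain ⟨S, hS⟩ := eventually_atTop.1 hev2
  have hnot : ∀ s ≥ S, ∀ n ≥ N, ¬ CloseToEarlier Y j n s := by
    intro s hs n hn hc
    obtain ⟨i, hi, hle⟩ := (closeToEarlier_iff j n s).1 hc
    refine absurd (hS s hs i hi) (not_lt.2 (hle.trans ?_))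
    gcongr
    exact one_le_two
  have hsub : {s | IsReplaced Y j s} ⊆ Set.Iic S ∪ ⋃ n ∈ Set.Iio N,
      {s | (n ≤ s ∧ CloseToEarlier Y j n s) ∧ ∀ r < s, ¬ (n ≤ r ∧ CloseToEarlier Y j n r)} := by
    rintro s (rfl | ⟨n, hn, hc, hr⟩)
    · exact Or.inl (Nat.zero_le _)
    · rcases le_or_gt s S with hs | hs
      · exact Or.inl hs
      · refine Or.inr (Set.mem_biUnion (x := n) ?_ ⟨⟨Nat.le_of_lt_succ hn, hc⟩, hr⟩)
        by_contra hnN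
        exact hnot s hs.le n (not_lt.1 hnN) hc
  refine Set.Finite.subset (Set.Finite.union (Set.finite_Iic S)
    (Set.Finite.biUnion (Set.finite_Iio N) fun n _ => Set.Subsingleton.finite ?_)) hsub
  rintro s ⟨hs, hs'⟩ t ⟨ht, ht'⟩
  rcases lt_trichotomy s t with h | h | h
  · exact absurd hs (ht' s h)
  · exact h
  · exact absurd ht (hs' t h)

variable {B : ℕ → ℕ → ℕ} {b : ℕ → ℝ}

open Classical in
/-- The real with index `⟨j, t⟩`: a follower of `y j` which, when it is replaced after stage `t`,
becomes the reserve real `b ⟨j, t⟩`. -/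
noncomputable def friedbergReal (Y : ℕ → ℕ → ℕ) (y b : ℕ → ℝ) (p : ℕ) : ℝ :=
  if ∃ r, p.unpair.2 < r ∧ IsReplaced Y p.unpair.1 r then b p
  else if IsReplaced Y p.unpair.1 p.unpair.2 then y p.unpair.1
  else b (Nat.pair p.unpair.1 (p.unpair.2 - 1))

open Classical in
/-- The approximations of `friedbergReal`. -/
noncomputable def friedbergApprox (Y B : ℕ → ℕ → ℕ) (p s : ℕ) : ℕ :=
  if ∃ r < s + 1, p.unpair.2 < r ∧ IsReplaced Y p.unpair.1 r then B p s
  else if IsReplaced Y p.unpair.1 p.unpair.2 then Y p.unpair.1 s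
  else B (Nat.pair p.unpair.1 (p.unpair.2 - 1)) s

theorem primrec_friedbergApprox (hY : Primrec₂ Y) (hB : Primrec₂ B) :
    Primrec₂ (friedbergApprox Y B) := by
  classical
  have hR := primrecRel_isReplaced hY
  have hj : Primrec fun q : ℕ × ℕ => q.1.unpair.1 := Primrec.fst.comp (Primrec.unpair.comp Primrec.fst)
  have ht : Primrec fun q : ℕ × ℕ => q.1.unpair.2 := Primrec.snd.comp (Primrec.unpair.comp Primrec.fst)
  have hR2 : PrimrecRel fun (r : ℕ) (q : ℕ × ℕ) => q.1.unpair.2 < r ∧ IsReplaced Y q.1.unpair.1 r :=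
    PrimrecPred.and (Primrec.nat_lt.comp (ht.comp Primrec.snd) Primrec.fst)
      (hR.comp (hj.comp Primrec.snd) Primrec.fst)
  refine Primrec.ite (hR2.bounded_exists (Primrec.succ.comp Primrec.snd)) hB
    (Primrec.ite (hR.comp hj ht) (hY.comp hj Primrec.snd) (hB.comp ?_ Primrec.snd))
  exact Primrec₂.natPair.comp hj (Primrec.nat_sub.comp ht (Primrec.const 1))

/-- The approximation changes target at most once, when a later replacement is seen, and then moves
to `b p`. The earlier targets are below `b p`: `y j` because `j ≤ p`, and `b ⟨j, t - 1⟩` by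
monotonicity. -/
theorem isApprox_friedbergReal (hY : ∀ j, IsApprox (Y j) (y j)) (hB : ∀ m, IsApprox (B m) (b m))
    (hb : StrictMono b) (hle : ∀ j m, j ≤ m → y j ≤ b m) (p : ℕ) :
    IsApprox (friedbergApprox Y B p) (friedbergReal Y y b p) := by
  classical
  have hpred : Nat.pair p.unpair.1 (p.unpair.2 - 1) ≤ p := by
    conv_rhs => rw [← Nat.pair_unpair p]
    rcases Nat.eq_zero_or_pos p.unpair.2 with h | h
    · simp [h]
    · exact (Nat.pair_lt_pair_right _ (Nat.sub_lt h one_pos)).le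
  by_cases hex : ∃ r, p.unpair.2 < r ∧ IsReplaced Y p.unpair.1 r
  · rw [friedbergReal, if_pos hex]
    obtain ⟨r, hr⟩ := hex
    constructor
    · intro s
      unfold friedbergApprox
      split_ifs
      · exact (hB p).le s
      · exact ((hY _).le s).trans (hle _ _ (Nat.unpair_left_le p))
      · exact ((hB _).le s).trans (hb.monotone hpred)
    · refine (hB p).tendsto.congr' ((eventually_ge_atTop r).mono fun s hs => ?_)
      simp only [friedbergApprox]
      rw [if_pos ⟨r, Nat.lt_succ_of_le hs, hr⟩]
  · have h : ∀ s, ¬ ∃ r < s + 1, p.unpair.2 < r ∧ IsReplaced Y p.unpair.1 r :=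
      fun s ⟨r, _, hr⟩ => hex ⟨r, hr⟩
    rw [friedbergReal, if_neg hex]
    have : friedbergApprox Y B p = fun s => if IsReplaced Y p.unpair.1 p.unpair.2
        then Y p.unpair.1 s else B (Nat.pair p.unpair.1 (p.unpair.2 - 1)) s := by
      funext s; rw [friedbergApprox, if_neg (h s)]
    rw [this]
    split_ifs
    · exact hY _
    · exact hB _

theorem friedbergReal_pair_cases (Y : ℕ → ℕ → ℕ) (y b : ℕ → ℝ) (j t : ℕ) :
    ((∃ r, t < r ∧ IsReplaced Y j r) ∧ friedbergReal Y y b (Nat.pair j t) = b (Nat.pair j t)) ∨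
    ((¬ ∃ r, t < r ∧ IsReplaced Y j r) ∧ IsReplaced Y j t ∧
      friedbergReal Y y b (Nat.pair j t) = y j) ∨
    ((¬ ∃ r, t < r ∧ IsReplaced Y j r) ∧ ¬ IsReplaced Y j t ∧
      friedbergReal Y y b (Nat.pair j t) = b (Nat.pair j (t - 1))) := by
  rw [friedbergReal, Nat.unpair_pair]
  dsimp only
  by_cases h1 : ∃ r, t < r ∧ IsReplaced Y j r
  · exact Or.inl ⟨h1, if_pos h1⟩
  · rw [if_neg h1]
    by_cases h2 : IsReplaced Y j t
    · exact Or.inr (Or.inl ⟨h1, h2, if_pos h2⟩)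
    · exact Or.inr (Or.inr ⟨h1, h2, if_neg h2⟩)

theorem injective_friedbergReal (hY : ∀ j, IsApprox (Y j) (y j)) (hb : Function.Injective b)
    (hne : ∀ j m, y j ≠ b m) : Function.Injective (friedbergReal Y y b) := by
  -- A follower that survives belongs to a `y j` with finitely many replacements, hence to the first
  -- occurrence of its value.
  have hfin : ∀ {i j t : ℕ}, (¬ ∃ r, t < r ∧ IsReplaced Y j r) → i < j → y i ≠ y j := by
    intro i j t ht hij h
    obtain ⟨r, hr, htr⟩ := (infinite_isReplaced hY hij h).exists_gt t
    exact ht ⟨r, htr, hr⟩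
  have h0 : ∀ j, IsReplaced Y j 0 := fun j => Or.inl rfl
  intro p q hpq
  obtain ⟨j, t, rfl⟩ : ∃ j t, p = Nat.pair j t := ⟨_, _, (Nat.pair_unpair p).symm⟩
  obtain ⟨j', t', rfl⟩ : ∃ j t, q = Nat.pair j t := ⟨_, _, (Nat.pair_unpair q).symm⟩
  rw [Nat.pair_eq_pair]
  rcases friedbergReal_pair_cases Y y b j t with ⟨⟨r, hr, hr'⟩, e⟩ | ⟨hno, ht, e⟩ | ⟨hno, ht, e⟩ <;>
  rcases friedbergReal_pair_cases Y y b j' t' with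
    ⟨⟨u, hu, hu'⟩, e'⟩ | ⟨hno', ht', e'⟩ | ⟨hno', ht', e'⟩ <;>
  rw [e, e'] at hpq
  · exact Nat.pair_eq_pair.1 (hb hpq)
  · exact absurd hpq.symm (hne _ _)
  · obtain ⟨rfl, rfl⟩ := Nat.pair_eq_pair.1 (hb hpq)
    refine absurd ⟨r, lt_of_le_of_ne (by omega) ?_, hr'⟩ hno'
    rintro rfl
    exact ht' hr'
  · exact absurd hpq (hne _ _)
  · obtain rfl : j = j' := by
      rcases lt_trichotomy j j' with h | h | h
      · exact absurd hpq (hfin hno' h)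
      · exact h
      · exact absurd hpq.symm (hfin hno h)
    refine ⟨rfl, ?_⟩
    rcases lt_trichotomy t t' with h | h | h
    · exact absurd ⟨t', h, ht'⟩ hno
    · exact h
    · exact absurd ⟨t, h, ht⟩ hno'
  · exact absurd hpq (hne _ _)
  · obtain ⟨rfl, rfl⟩ := Nat.pair_eq_pair.1 (hb hpq)
    refine absurd ⟨u, lt_of_le_of_ne (by omega) ?_, hu'⟩ hno
    rintro rfl
    exact ht hu'
  · exact absurd hpq.symm (hne _ _)
  · obtain ⟨rfl, h⟩ := Nat.pair_eq_pair.1 (hb hpq)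
    -- Stage `0` always counts as a replacement, so the truncated `t - 1` is a true predecessor
    -- here.
    have h1 : t ≠ 0 := by rintro rfl; exact ht (h0 _)
    have h2 : t' ≠ 0 := by rintro rfl; exact ht' (h0 _)
    exact ⟨rfl, by omega⟩

theorem range_friedbergReal (hY : ∀ j, IsApprox (Y j) (y j)) :
    Set.range (friedbergReal Y y b) = Set.range y ∪ Set.range b := by
  classical
  apply Set.Subset.antisymm
  · rintro _ ⟨p, rfl⟩
    unfold friedbergReal
    split_ifs
    · exact Or.inr ⟨_, rfl⟩
    · exact Or.inl ⟨_, rfl⟩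
    · exact Or.inr ⟨_, rfl⟩
  · rintro _ (⟨j₀, rfl⟩ | ⟨m, rfl⟩)
    · have hex : ∃ j, y j = y j₀ := ⟨j₀, rfl⟩
      -- The least index of the value has finitely many replacements, and the last one appoints the
      -- permanent follower.
      obtain ⟨j, hj⟩ : ∃ j, j = Nat.find hex := ⟨_, rfl⟩
      have hj1 : y j = y j₀ := hj ▸ Nat.find_spec hex
      have hfin : {s | IsReplaced Y j s}.Finite := finite_isReplaced hY fun i hi h =>
        Nat.find_min hex (hj ▸ hi) (h.trans hj1)
      obtain ⟨t, ht, hmax⟩ := hfin.exists_maximal ⟨0, Or.inl rfl⟩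
      refine ⟨Nat.pair j t, ?_⟩
      have ht' : IsReplaced Y j t := ht
      rw [← hj1, friedbergReal, Nat.unpair_pair, if_neg, if_pos ht']
      rintro ⟨r, hr, hr'⟩
      exact absurd (hmax hr' hr.le) (not_le.2 hr)
    · by_cases h : ∃ r, m.unpair.2 < r ∧ IsReplaced Y m.unpair.1 r
      · exact ⟨m, if_pos h⟩
      -- From the last replacement stage on, reserve reals are shifted by one index to make room for
      -- `y j`.
      · refine ⟨Nat.pair m.unpair.1 (m.unpair.2 + 1), ?_⟩
        rw [friedbergReal, Nat.unpair_pair, if_neg, if_neg]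
        · simp
        · exact fun hr => h ⟨_, Nat.lt_succ_self _, hr⟩
        · rintro ⟨r, hr, hr'⟩
          exact h ⟨r, (Nat.lt_succ_self _).trans hr, hr'⟩

/-- If a uniformly left-c.e. sequence `y` is disjoint from a strictly increasing one `b` whose
terms eventually bound each `y j` computably, then the union of both families has an injective
uniformly left-c.e. enumeration. -/
theorem exists_injective_isLeftCESeq (hy : IsLeftCESeq y) (hbc : IsLeftCESeq b) (hb : StrictMono b)
    (hne : ∀ j m, y j ≠ b m) (hle : ∀ j m, j ≤ m → y j ≤ b m) :
    ∃ w : ℕ → ℝ, Function.Injective w ∧ IsLeftCESeq w ∧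
      Set.range w = Set.range y ∪ Set.range b := by
  obtain ⟨Y, hYp, hY⟩ := hy
  obtain ⟨B, hBp, hB⟩ := hbc
  exact ⟨friedbergReal Y y b, injective_friedbergReal hY hb.injective hne,
    ⟨friedbergApprox Y B, primrec_friedbergApprox hYp hBp, isApprox_friedbergReal hY hB hb hle⟩,
    range_friedbergReal hY⟩

end Friedberg

/-! ### Separating the sequence from the reserve by clamping. -/

/-- The real `u` is a nonnegative dyadic rational. -/
def IsDyadicReal (u : ℝ) : Prop := ∃ a b : ℕ, u = (a : ℝ) / 2 ^ b

theorem lower_endpoint_eq (k n : ℕ) : ((2 ^ (n + k + 2) - 2 ^ (n + 2) + 1 : ℕ) : ℝ) / 2 ^ (n + k + 2) =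
    1 - 1 / 2 ^ k + 1 / 2 ^ (n + k + 2) := by
  have h : 2 ^ (n + 2) ≤ 2 ^ (n + k + 2) := Nat.pow_le_pow_right two_pos (by omega)
  push_cast [h]
  rw [show n + k + 2 = k + (n + 2) by ring, pow_add]
  field_simp

theorem upper_endpoint_eq (k n : ℕ) : ((2 ^ (n + k + 2) - (2 ^ (n + 1) + 1) : ℕ) : ℝ) / 2 ^ (n + k + 2) =
    1 - 1 / 2 ^ (k + 1) - 1 / 2 ^ (n + k + 2) := by
  have h1 : 1 ≤ 2 ^ (n + 1) := Nat.one_le_two_pow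
  have h2 : 2 ^ (n + 1) + 1 ≤ 2 ^ (n + k + 2) := by
    have : 2 ^ (n + 2) ≤ 2 ^ (n + k + 2) := Nat.pow_le_pow_right two_pos (by omega)
    rw [pow_succ] at this
    omega
  rw [Nat.cast_sub h2]
  push_cast
  rw [show n + k + 2 = (k + 1) + (n + 1) by ring, pow_add _ (k + 1)]
  field_simp
  ring

/-- The member of index `⟨c, k, n⟩` of the clamps of the reals `x c` to the intervals
`[1 - 2 ^ (-k) + ε, 1 - 2 ^ (-(k + 1)) - ε]` with `ε = 2 ^ (-(n + k + 2))`. -/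
noncomputable def clampedReal (x : ℕ → ℝ) (j : ℕ) : ℝ :=
  min (max (x j.unpair.1)
    (1 - 1 / 2 ^ j.unpair.2.unpair.1 + 1 / 2 ^ (j.unpair.2.unpair.2 + j.unpair.2.unpair.1 + 2)))
    (1 - 1 / 2 ^ (j.unpair.2.unpair.1 + 1) -
      1 / 2 ^ (j.unpair.2.unpair.2 + j.unpair.2.unpair.1 + 2))

theorem isLeftCESeq_clampedReal {x : ℕ → ℝ} (hx : IsLeftCESeq x) :
    IsLeftCESeq (clampedReal x) := by
  obtain ⟨X, hXp, hX⟩ := hx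
  refine ⟨fun j s => min (max (X j.unpair.1 s)
    (dyadicApprox (2 ^ (j.unpair.2.unpair.2 + j.unpair.2.unpair.1 + 2) -
      2 ^ (j.unpair.2.unpair.2 + 2) + 1) (j.unpair.2.unpair.2 + j.unpair.2.unpair.1 + 2) s))
    (dyadicApprox (2 ^ (j.unpair.2.unpair.2 + j.unpair.2.unpair.1 + 2) -
      (2 ^ (j.unpair.2.unpair.2 + 1) + 1)) (j.unpair.2.unpair.2 + j.unpair.2.unpair.1 + 2) s),
    ?_, fun j => ?_⟩
  · have hc : Primrec fun q : ℕ × ℕ => q.1.unpair.1 :=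
      Primrec.fst.comp (Primrec.unpair.comp Primrec.fst)
    have hp : Primrec fun q : ℕ × ℕ => q.1.unpair.2 :=
      Primrec.snd.comp (Primrec.unpair.comp Primrec.fst)
    have hk : Primrec fun q : ℕ × ℕ => q.1.unpair.2.unpair.1 :=
      Primrec.fst.comp (Primrec.unpair.comp hp)
    have hn : Primrec fun q : ℕ × ℕ => q.1.unpair.2.unpair.2 :=
      Primrec.snd.comp (Primrec.unpair.comp hp)
    have hN := Primrec.nat_add.comp (Primrec.nat_add.comp hn hk) (Primrec.const 2)
    refine Primrec.nat_min.comp (Primrec.nat_max.comp (hXp.comp hc Primrec.snd)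
      (primrec_dyadicApprox (Primrec.nat_add.comp (Primrec.nat_sub.comp (primrec_two_pow hN)
        (primrec_two_pow (Primrec.nat_add.comp hn (Primrec.const 2)))) (Primrec.const 1))
        hN Primrec.snd))
      (primrec_dyadicApprox (Primrec.nat_sub.comp (primrec_two_pow hN) (Primrec.nat_add.comp
        (primrec_two_pow (Primrec.nat_add.comp hn (Primrec.const 1))) (Primrec.const 1)))
        hN Primrec.snd)
  · rw [clampedReal, ← lower_endpoint_eq, ← upper_endpoint_eq]
    exact ((hX _).max (isApprox_dyadicApprox _ _)).min (isApprox_dyadicApprox _ _)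

/-- The outer `min` may select the upper endpoint, so that endpoint must also exceed `1 - 2 ^ (-k)`;
this holds because `ε < 2 ^ (-(k + 1))`. -/
theorem lt_clampedReal (x : ℕ → ℝ) (j : ℕ) :
    1 - 1 / 2 ^ j.unpair.2.unpair.1 < clampedReal x j := by
  unfold clampedReal
  generalize j.unpair.2.unpair.1 = k
  generalize j.unpair.2.unpair.2 = n
  refine lt_min (lt_max_of_lt_right (lt_add_of_pos_right _ (by positivity))) ?_
  have h2 : (1 : ℝ) / 2 ^ (n + k + 2) < 1 / 2 ^ (k + 1) :=
    one_div_lt_one_div_of_lt (by positivity) (pow_lt_pow_right₀ one_lt_two (by omega))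
  have h3 : (1 : ℝ) / 2 ^ k = 1 / 2 ^ (k + 1) + 1 / 2 ^ (k + 1) := by
    rw [pow_succ]; field_simp; norm_num
  linarith

theorem clampedReal_lt (x : ℕ → ℝ) (j : ℕ) :
    clampedReal x j < 1 - 1 / 2 ^ (j.unpair.2.unpair.1 + 1) :=
  (min_le_right _ _).trans_lt (sub_lt_self _ (by positivity))

theorem clampedReal_mem_range_or_isDyadicReal (x : ℕ → ℝ) (j : ℕ) :
    clampedReal x j ∈ Set.range x ∨ IsDyadicReal (clampedReal x j) := by
  unfold clampedReal
  rcases min_choice (max (x j.unpair.1) (1 - 1 / 2 ^ j.unpair.2.unpair.1 +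
    1 / 2 ^ (j.unpair.2.unpair.2 + j.unpair.2.unpair.1 + 2)))
    (1 - 1 / 2 ^ (j.unpair.2.unpair.1 + 1) -
      1 / 2 ^ (j.unpair.2.unpair.2 + j.unpair.2.unpair.1 + 2)) with h | h
  · rw [h]
    rcases max_choice (x j.unpair.1) (1 - 1 / 2 ^ j.unpair.2.unpair.1 +
      1 / 2 ^ (j.unpair.2.unpair.2 + j.unpair.2.unpair.1 + 2)) with h' | h'
    · exact Or.inl ⟨_, h'.symm⟩
    · exact Or.inr ⟨_, _, h'.trans (lower_endpoint_eq _ _).symm⟩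
  · exact Or.inr ⟨_, _, h.trans (upper_endpoint_eq _ _).symm⟩

/-- The strictly increasing sequence `1 / 2, 3 / 4, 7 / 8, …`. -/
noncomputable def reserveReal (m : ℕ) : ℝ := 1 - 1 / 2 ^ (m + 1)

theorem reserveReal_eq (m : ℕ) : reserveReal m = ((2 ^ (m + 1) - 1 : ℕ) : ℝ) / 2 ^ (m + 1) := by
  rw [reserveReal, Nat.cast_sub Nat.one_le_two_pow]
  push_cast
  field_simp

theorem one_sub_one_div_two_pow_strictMono : StrictMono fun k : ℕ => (1 : ℝ) - 1 / 2 ^ k :=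
  strictMono_nat_of_lt_succ fun k => sub_lt_sub_left
    (one_div_lt_one_div_of_lt (by positivity) (pow_lt_pow_right₀ one_lt_two (Nat.lt_succ_self k))) _

theorem reserveReal_strictMono : StrictMono reserveReal := fun _ _ h =>
  one_sub_one_div_two_pow_strictMono (Nat.succ_lt_succ h)

theorem isLeftCESeq_reserveReal : IsLeftCESeq reserveReal := by
  refine ⟨fun m s => dyadicApprox (2 ^ (m + 1) - 1) (m + 1) s, ?_, fun m => ?_⟩
  · have hm : Primrec fun q : ℕ × ℕ => q.1 + 1 := Primrec.succ.comp Primrec.fst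
    exact primrec_dyadicApprox (Primrec.nat_sub.comp (primrec_two_pow hm) (Primrec.const 1)) hm
      Primrec.snd
  · rw [reserveReal_eq]
    exact isApprox_dyadicApprox _ _

theorem clampedReal_lt_reserveReal (x : ℕ → ℝ) {j m : ℕ} (h : j.unpair.2.unpair.1 ≤ m) :
    clampedReal x j < reserveReal m :=
  (clampedReal_lt x j).trans_le (reserveReal_strictMono.monotone h)

theorem clampedReal_ne_reserveReal (x : ℕ → ℝ) (j m : ℕ) : clampedReal x j ≠ reserveReal m := by
  rcases le_or_gt j.unpair.2.unpair.1 m with h | h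
  · exact (clampedReal_lt_reserveReal x h).ne
  · exact ((one_sub_one_div_two_pow_strictMono.monotone h).trans_lt (lt_clampedReal x j)).ne'

/-- Outside the reserve, `x c` lies strictly inside one gap, and for large `n` the margin `ε` is so
small that the clamp leaves it unchanged. -/
theorem mem_range_clampedReal (x : ℕ → ℝ) {c : ℕ} (h0 : 0 < x c) (h1 : x c < 1)
    (hne : ∀ m, x c ≠ reserveReal m) : x c ∈ Set.range (clampedReal x) := by
  classical
  have hpow : ∀ ε : ℝ, 0 < ε → ∃ n : ℕ, (1 : ℝ) / 2 ^ n < ε := fun ε hε => by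
    simpa using exists_pow_lt_of_lt_one hε (by norm_num : (1 / 2 : ℝ) < 1)
  have hex : ∃ k : ℕ, x c < 1 - 1 / 2 ^ (k + 1) := by
    obtain ⟨n, hn⟩ := hpow (1 - x c) (sub_pos.2 h1)
    have := one_sub_one_div_two_pow_strictMono (Nat.lt_succ_self n)
    exact ⟨n, by simp only [Nat.succ_eq_add_one] at this; linarith⟩
  obtain ⟨k, hk⟩ : ∃ k, k = Nat.find hex := ⟨_, rfl⟩
  have hk1 : x c < 1 - 1 / 2 ^ (k + 1) := hk ▸ Nat.find_spec hex
  have hk0 : 1 - 1 / 2 ^ k < x c := by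
    rcases k with _ | k
    · simpa using h0
    · exact lt_of_le_of_ne (not_lt.1 (Nat.find_min hex (hk ▸ Nat.lt_succ_self k))) (hne k).symm
  obtain ⟨n, hn⟩ := hpow (min (x c - (1 - 1 / 2 ^ k)) (1 - 1 / 2 ^ (k + 1) - x c))
    (lt_min (by linarith) (by linarith))
  obtain ⟨hn1, hn2⟩ := lt_min_iff.1 hn
  have hn3 : (1 : ℝ) / 2 ^ (n + k + 2) ≤ 1 / 2 ^ n :=
    one_div_le_one_div_of_le (by positivity) (pow_le_pow_right₀ one_le_two (by omega))
  refine ⟨Nat.pair c (Nat.pair k n), ?_⟩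
  simp only [clampedReal, Nat.unpair_pair]
  rw [max_eq_left (by linarith), min_eq_left (by linarith)]

/-- The members in `(0, 1)` of a uniformly left-c.e. sequence, together with some dyadic rationals
in `(0, 1)`, have an injective uniformly left-c.e. enumeration. -/
theorem IsLeftCESeq.exists_injective {x : ℕ → ℝ} (hx : IsLeftCESeq x) :
    ∃ w : ℕ → ℝ, Function.Injective w ∧ IsLeftCESeq w ∧
      (∀ e, 0 < w e ∧ w e < 1 ∧ (w e ∈ Set.range x ∨ IsDyadicReal (w e))) ∧
      ∀ c, 0 < x c → x c < 1 → x c ∈ Set.range w := by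
  obtain ⟨w, hinj, hw, hrange⟩ := exists_injective_isLeftCESeq (isLeftCESeq_clampedReal hx)
    isLeftCESeq_reserveReal reserveReal_strictMono (clampedReal_ne_reserveReal x)
    -- The gap number `k` is a component of the code `j`, whence `k ≤ j ≤ m`.
    fun j m h => (clampedReal_lt_reserveReal x
      (((Nat.unpair_left_le _).trans (Nat.unpair_right_le j)).trans h)).le
  have hbound : ∀ k : ℕ, 0 ≤ (1 : ℝ) - 1 / 2 ^ k := fun k => by
    simpa using one_sub_one_div_two_pow_strictMono.monotone (Nat.zero_le k)
  have hlt : ∀ k : ℕ, (1 : ℝ) - 1 / 2 ^ k < 1 := fun k => sub_lt_self _ (by positivity)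
  refine ⟨w, hinj, hw, fun e => ?_, fun c h0 h1 => ?_⟩
  · have he : w e ∈ Set.range w := ⟨e, rfl⟩
    rw [hrange] at he
    rcases he with ⟨j, hj⟩ | ⟨m, hm⟩
    · rw [← hj]
      exact ⟨(hbound _).trans_lt (lt_clampedReal x j), (clampedReal_lt x j).trans (hlt _),
        clampedReal_mem_range_or_isDyadicReal x j⟩
    · rw [← hm]
      refine ⟨(hbound m).trans_lt (one_sub_one_div_two_pow_strictMono (Nat.lt_succ_self m)),
        hlt _, Or.inr ⟨_, _, reserveReal_eq m⟩⟩
  · rw [hrange]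
    by_cases h : ∃ m, x c = reserveReal m
    · obtain ⟨m, hm⟩ := h
      exact Or.inr ⟨m, hm.symm⟩
    · exact Or.inl (mem_range_clampedReal x h0 h1 fun m hm => h ⟨m, hm⟩)

/-! ### Injective enumerations of the left-c.e. values and of the dyadic values. -/

/-- The left-c.e. reals in `[0, 1]` have an injective uniformly left-c.e. enumeration. -/
theorem exists_injective_enumeration_leftCEReals :
    ∃ v : ℕ → ℝ, Function.Injective v ∧ IsLeftCESeq v ∧
      Set.range v = {u | 0 ≤ u ∧ u ≤ 1 ∧ IsLeftCEReal u} := by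
  obtain ⟨w, hinj, hw, hw01, hsurj⟩ := IsLeftCESeq.exists_injective
    ⟨universalApprox, primrec_universalApprox, isApprox_universalReal⟩
  -- Index `0` receives the value `1` and index `1` the value `0`; the sequence `w` lives in the
  -- open interval.
  have hv := (hw.cons 0 0).cons 1 0
  refine ⟨_, ?_, hv, Set.Subset.antisymm ?_ ?_⟩
  · rintro (_ | _ | e) (_ | _ | e') h
    · rfl
    · simp at h
    · exact absurd h (by simpa using (hw01 e').2.1.ne')
    · simp at h
    · rfl
    · exact absurd h (by simpa using (hw01 e').1.ne)
    · exact absurd h (by simpa using (hw01 e).2.1.ne)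
    · exact absurd h (by simpa using (hw01 e).1.ne')
    · rw [hinj h]
  · rintro _ ⟨e, rfl⟩
    have hbound : 0 ≤ (Nat.casesOn e (((1 : ℕ) : ℝ) / 2 ^ 0) (fun n =>
        Nat.casesOn n (((0 : ℕ) : ℝ) / 2 ^ 0) w) : ℝ) ∧ (Nat.casesOn e (((1 : ℕ) : ℝ) / 2 ^ 0)
        (fun n => Nat.casesOn n (((0 : ℕ) : ℝ) / 2 ^ 0) w) : ℝ) ≤ 1 := by
      rcases e with _ | _ | e
      · simp
      · simp
      · exact ⟨(hw01 e).1.le, (hw01 e).2.1.le⟩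
    exact ⟨hbound.1, hbound.2, hv.isLeftCEReal e⟩
  · rintro u ⟨h0, h1, hu⟩
    rcases h0.eq_or_lt with rfl | h0
    · exact ⟨1, by simp⟩
    rcases h1.eq_or_lt with rfl | h1
    · exact ⟨0, by simp⟩
    obtain ⟨c, rfl⟩ := exists_universalReal_eq h0 h1.le hu
    obtain ⟨e, he⟩ := hsurj c h0 h1
    exact ⟨e + 2, he⟩

/-- The dyadic rationals in `(0, 1)` have an injective uniformly left-c.e. enumeration. -/
theorem exists_injective_enumeration_dyadicReals :
    ∃ d : ℕ → ℝ, Function.Injective d ∧ IsLeftCESeq d ∧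
      Set.range d = {u | 0 < u ∧ u < 1 ∧ IsDyadicReal u} := by
  have hx : IsLeftCESeq fun c : ℕ => (c.unpair.1 : ℝ) / 2 ^ c.unpair.2 :=
    ⟨fun c s => dyadicApprox c.unpair.1 c.unpair.2 s,
      primrec_dyadicApprox (Primrec.fst.comp (Primrec.unpair.comp Primrec.fst))
        (Primrec.snd.comp (Primrec.unpair.comp Primrec.fst)) Primrec.snd,
      fun c => isApprox_dyadicApprox _ _⟩
  obtain ⟨d, hinj, hd, hd01, hsurj⟩ := hx.exists_injective
  refine ⟨d, hinj, hd, Set.Subset.antisymm ?_ ?_⟩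
  · rintro _ ⟨e, rfl⟩
    refine ⟨(hd01 e).1, (hd01 e).2.1, (hd01 e).2.2.elim ?_ id⟩
    rintro ⟨c, hc⟩
    exact ⟨_, _, hc.symm⟩
  · rintro _ ⟨h0, h1, a, b, rfl⟩
    simpa using hsurj (Nat.pair a b) (by simpa using h0) (by simpa using h1)

theorem IsLeftCESeq.interleave {v w : ℕ → ℝ} (hv : IsLeftCESeq v) (hw : IsLeftCESeq w) :
    IsLeftCESeq fun n => if n % 2 = 0 then v (n / 2) else w (n / 2) := by
  obtain ⟨F, hF, hFv⟩ := hv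
  obtain ⟨G, hG, hGw⟩ := hw
  refine ⟨fun n s => if n % 2 = 0 then F (n / 2) s else G (n / 2) s, ?_, fun n => ?_⟩
  · have h2 : Primrec fun q : ℕ × ℕ => q.1 / 2 := Primrec.nat_div.comp Primrec.fst (Primrec.const 2)
    exact Primrec.ite (Primrec.eq.comp (Primrec.nat_mod.comp Primrec.fst (Primrec.const 2))
      (Primrec.const 0)) (hF.comp h2 Primrec.snd) (hG.comp h2 Primrec.snd)
  · by_cases h : n % 2 = 0
    · simpa only [if_pos h] using hFv (n / 2)
    · simpa only [if_neg h] using hGw (n / 2)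

/-! ### Uniqueness and duplication of binary expansions. -/

namespace CantorSpace

theorem value_nonneg (x : CantorSpace) : 0 ≤ x.value := Real.ofDigits_nonneg x

theorem value_le_one (x : CantorSpace) : x.value ≤ 1 := Real.ofDigits_le_one x

theorem value_eq (x : CantorSpace) :
    x.value = ((x 0 : ℕ) + value fun i => x (i + 1)) / 2 := by
  have h := Real.ofDigits_eq_sum_add_ofDigits x 1
  rw [value, h, value]
  simp [Real.ofDigitsTerm]
  ring

/-- The sequence with first term `i` and then the terms of `x`. -/
def cons (i : Fin 2) (x : CantorSpace) : CantorSpace := fun n => Nat.casesOn n i x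

theorem value_cons (i : Fin 2) (x : CantorSpace) : (cons i x).value = ((i : ℕ) + x.value) / 2 :=
  value_eq _

/-- The terms of `x` are eventually equal to `i`. -/
def EventuallyEq (x : CantorSpace) (i : Fin 2) : Prop := ∃ n, ∀ m ≥ n, x m = i

theorem EventuallyEq.cons {x : CantorSpace} {i : Fin 2} (h : x.EventuallyEq i) (j : Fin 2) :
    (cons j x).EventuallyEq i := by
  obtain ⟨n, hn⟩ := h
  refine ⟨n + 1, fun m hm => ?_⟩
  obtain ⟨m, rfl⟩ := Nat.exists_eq_add_of_le' (Nat.one_le_of_lt hm)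
  exact hn m (by omega)

theorem EventuallyEq.of_tail {x : CantorSpace} {i : Fin 2}
    (h : EventuallyEq (fun n => x (n + 1)) i) : x.EventuallyEq i := by
  obtain ⟨n, hn⟩ := h
  refine ⟨n + 1, fun m hm => ?_⟩
  obtain ⟨m, rfl⟩ := Nat.exists_eq_add_of_le' (Nat.one_le_of_lt hm)
  exact hn m (by omega)

theorem EventuallyEq.unique {x : CantorSpace} {i j : Fin 2} (hi : x.EventuallyEq i)
    (hj : x.EventuallyEq j) : i = j := by
  obtain ⟨n, hn⟩ := hi
  obtain ⟨m, hm⟩ := hj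
  rw [← hn (max n m) (le_max_left _ _), hm (max n m) (le_max_right _ _)]

theorem value_const_zero : value (fun _ => 0) = 0 := by
  have h := value_eq fun _ => 0
  simp only [Fin.val_zero, Nat.cast_zero, zero_add] at h
  linarith

theorem value_const_one : value (fun _ => 1) = 1 := by
  have h := value_eq fun _ => 1
  simp only [Fin.val_one, Nat.cast_one] at h
  linarith

/-- By `value_eq` a zero value forces a zero first digit and a tail of value zero, and the argument
repeats on the tail. -/
theorem eq_zero_of_value_eq_zero {x : CantorSpace} (h : x.value = 0) (n : ℕ) : x n = 0 := by
  have h1 := value_eq x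
  have h2 := value_nonneg fun i => x (i + 1)
  have h3 : (0 : ℝ) ≤ (x 0 : ℕ) := Nat.cast_nonneg _
  induction n generalizing x with
  | zero =>
    have : ((x 0 : ℕ) : ℝ) = 0 := by linarith
    exact Fin.ext (Nat.cast_eq_zero.1 this)
  | succ n ih =>
    exact ih (x := fun i => x (i + 1)) (by linarith) (value_eq _) (value_nonneg _)
      (Nat.cast_nonneg _)

theorem eq_one_of_value_eq_one {x : CantorSpace} (h : x.value = 1) (n : ℕ) : x n = 1 := by
  have h1 := value_eq x
  have h2 := value_le_one fun i => x (i + 1)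
  have h3 : ((x 0 : ℕ) : ℝ) ≤ 1 := by exact_mod_cast Nat.le_of_lt_succ (x 0).2
  induction n generalizing x with
  | zero =>
    have : ((x 0 : ℕ) : ℝ) = 1 := by linarith
    exact Fin.ext (by exact_mod_cast this)
  | succ n ih =>
    exact ih (x := fun i => x (i + 1)) (by linarith) (value_eq _) (value_le_one _)
      (by exact_mod_cast Nat.le_of_lt_succ (x 1).2)

theorem eventuallyEq_of_value_eq_of_head {x y : CantorSpace} (h : x.value = y.value)
    (hx : x 0 = 0) (hy : y 0 = 1) : x.EventuallyEq 1 ∧ y.EventuallyEq 0 := by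
  have h1 := value_eq x
  have h2 := value_eq y
  rw [hx] at h1
  rw [hy] at h2
  have h3 := value_le_one fun i => x (i + 1)
  have h4 := value_nonneg fun i => y (i + 1)
  simp only [Fin.val_zero, Nat.cast_zero, Fin.val_one, Nat.cast_one] at h1 h2
  exact ⟨EventuallyEq.of_tail ⟨0, fun m _ =>
      eq_one_of_value_eq_one (x := fun i => x (i + 1)) (by linarith) m⟩,
    EventuallyEq.of_tail ⟨0, fun m _ =>
      eq_zero_of_value_eq_zero (x := fun i => y (i + 1)) (by linarith) m⟩⟩

/-- Two different binary expansions of the same number: one ends in zeros, the other in ones. -/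
theorem eventuallyEq_of_value_eq {x y : CantorSpace} (h : x.value = y.value) (hxy : x ≠ y) :
    (x.EventuallyEq 0 ∧ y.EventuallyEq 1) ∨ (x.EventuallyEq 1 ∧ y.EventuallyEq 0) := by
  obtain ⟨n, hn⟩ := Function.ne_iff.1 hxy
  clear hxy
  have head : ∀ x y : CantorSpace, x.value = y.value → x 0 ≠ y 0 →
      (x.EventuallyEq 0 ∧ y.EventuallyEq 1) ∨ (x.EventuallyEq 1 ∧ y.EventuallyEq 0) := by
    intro x y h h0
    rcases Fin.exists_fin_two.1 ⟨x 0, rfl⟩ with hx | hx <;>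
    rcases Fin.exists_fin_two.1 ⟨y 0, rfl⟩ with hy | hy
    · exact absurd (hx.trans hy.symm) h0
    · exact Or.inr (eventuallyEq_of_value_eq_of_head h hx hy)
    · exact Or.inl (eventuallyEq_of_value_eq_of_head h.symm hy hx).symm
    · exact absurd (hx.trans hy.symm) h0
  induction n generalizing x y with
  | zero => exact head x y h hn
  | succ n ih =>
    by_cases h0 : x 0 = y 0
    · have htail : value (fun i => x (i + 1)) = value fun i => y (i + 1) := by
        have h1 := value_eq x
        have h2 := value_eq y
        rw [h0] at h1
        linarith
      exact (ih htail hn).imp (And.imp EventuallyEq.of_tail EventuallyEq.of_tail)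
        (And.imp EventuallyEq.of_tail EventuallyEq.of_tail)
    · exact head x y h h0

theorem isDyadicReal_of_eventuallyEq_zero {x : CantorSpace} (h : x.EventuallyEq 0) :
    IsDyadicReal x.value := by
  obtain ⟨n, hn⟩ := h
  induction n generalizing x with
  | zero =>
    obtain rfl : x = fun _ => 0 := funext fun m => hn m (Nat.zero_le m)
    exact ⟨0, 0, by simp [value_const_zero]⟩
  | succ n ih =>
    obtain ⟨a, b, hab⟩ := ih (x := fun i => x (i + 1)) fun m hm => hn (m + 1) (by omega)
    refine ⟨(x 0 : ℕ) * 2 ^ b + a, b + 1, ?_⟩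
    rw [value_eq, hab]
    push_cast
    rw [pow_succ]
    field_simp

/-- Induction on the exponent: doubling `u` shifts the expansion, and comparing `2 * u` with `1`
decides the first digit. At `2 * u = 1` the expansions `1000…` and `0111…` separate. -/
theorem exists_two_expansions {u : ℝ} (h0 : 0 < u) (h1 : u < 1) (hu : IsDyadicReal u) :
    ∃ x y : CantorSpace, x.EventuallyEq 0 ∧ y.EventuallyEq 1 ∧ x.value = u ∧ y.value = u := by
  obtain ⟨a, b, hab⟩ := hu
  induction b generalizing u a with
  | zero =>
    rw [hab, pow_zero, div_one] at h0 h1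
    norm_cast at h0 h1
    omega
  | succ b ih =>
    have h2 : 2 * u = (a : ℝ) / 2 ^ b := by rw [hab, pow_succ]; field_simp
    rcases lt_trichotomy (2 * u) 1 with h | h | h
    · obtain ⟨x, y, hx, hy, hxu, hyu⟩ := ih (by linarith) h a h2
      refine ⟨cons 0 x, cons 0 y, hx.cons 0, hy.cons 0, ?_, ?_⟩ <;>
        rw [value_cons] <;> simp [hxu, hyu]
    · refine ⟨cons 1 fun _ => 0, cons 0 fun _ => 1, EventuallyEq.cons ⟨0, fun _ _ => rfl⟩ _,
        EventuallyEq.cons ⟨0, fun _ _ => rfl⟩ _, ?_, ?_⟩ <;>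
        rw [value_cons] <;> simp [value_const_zero, value_const_one] <;> linarith
    · have hle : 2 ^ b ≤ a := by
        rw [h2, lt_div_iff₀ (by positivity), one_mul] at h
        exact_mod_cast h.le
      obtain ⟨x, y, hx, hy, hxu, hyu⟩ := ih (u := 2 * u - 1) (by linarith) (by linarith)
        (a - 2 ^ b) (by rw [h2, Nat.cast_sub hle]; push_cast; field_simp)
      refine ⟨cons 1 x, cons 1 y, hx.cons 1, hy.cons 1, ?_, ?_⟩ <;>
        rw [value_cons] <;> simp [hxu, hyu]

/-- The expansion `x` does not end in zeros, unless it is the expansion of `0`. -/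
def IsNonterminating (x : CantorSpace) : Prop := x.EventuallyEq 0 → x.value = 0

theorem exists_isNonterminating {u : ℝ} (h0 : 0 ≤ u) (h1 : u ≤ 1) :
    ∃ x : CantorSpace, x.IsNonterminating ∧ x.value = u := by
  obtain ⟨x, -, hx⟩ := Real.ofDigits_SurjOn (b := 2) one_lt_two ⟨h0, h1⟩
  change value x = u at hx
  by_cases hz : EventuallyEq x 0
  · rcases h0.eq_or_lt with rfl | h0
    · exact ⟨x, fun _ => hx, hx⟩
    rcases h1.eq_or_lt with rfl | h1
    · exact ⟨fun _ => 1, fun h => absurd (h.unique ⟨0, fun _ _ => rfl⟩) zero_ne_one, value_const_one⟩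
    obtain ⟨-, y, -, hy, -, hyu⟩ :=
      exists_two_expansions h0 h1 (hx ▸ isDyadicReal_of_eventuallyEq_zero hz)
    exact ⟨y, fun h => absurd (h.unique hy) zero_ne_one, hyu⟩
  · exact ⟨x, fun h => absurd h hz, hx⟩

/-- If two expansions of one value differ, one of them ends in zeros, so the value is `0`, which has
only one expansion. -/
theorem IsNonterminating.eq_of_value_eq {x y : CantorSpace} (hx : x.IsNonterminating)
    (hy : y.IsNonterminating) (h : x.value = y.value) : x = y := by
  by_contra hxy
  have h0 : x.value = 0 := by
    rcases eventuallyEq_of_value_eq h hxy with h' | h'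
    · exact hx h'.1
    · exact h.trans (hy h'.2)
  exact hxy (funext fun n => (eq_zero_of_value_eq_zero h0 n).trans
    (eq_zero_of_value_eq_zero (h ▸ h0) n).symm)

theorem EventuallyEq.eq_of_value_eq {x y : CantorSpace} (hx : x.EventuallyEq 0)
    (hy : y.EventuallyEq 0) (h : x.value = y.value) : x = y := by
  by_contra hxy
  rcases eventuallyEq_of_value_eq h hxy with h' | h'
  · exact zero_ne_one (hy.unique h'.2)
  · exact zero_ne_one (hx.unique h'.1)

end CantorSpace

/-! ### Friedberg numberings in Cantor space and in the reals. -/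

theorem exists_isFriedbergNumbering :
    ∃ r : ℕ → CantorSpace, IsFriedbergNumbering {x | IsLeftCE x} r := by
  obtain ⟨v, hvinj, hv, hvr⟩ := exists_injective_enumeration_leftCEReals
  obtain ⟨d, hdinj, hd, hdr⟩ := exists_injective_enumeration_dyadicReals
  have hv01 : ∀ e, 0 ≤ v e ∧ v e ≤ 1 := fun e => by
    have h : v e ∈ Set.range v := ⟨e, rfl⟩
    rw [hvr] at h
    exact ⟨h.1, h.2.1⟩
  have hd01 : ∀ e, 0 < d e ∧ d e < 1 ∧ IsDyadicReal (d e) := fun e => by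
    have h : d e ∈ Set.range d := ⟨e, rfl⟩
    rwa [hdr] at h
  choose f hf hfv using fun e => CantorSpace.exists_isNonterminating (hv01 e).1 (hv01 e).2
  choose g _ hg _ hgd _ using fun e =>
    CantorSpace.exists_two_expansions (hd01 e).1 (hd01 e).2.1 (hd01 e).2.2
  -- A common member would be nonterminating and end in zeros, hence have value `0`, while `d n` is
  -- positive.
  have hfg : ∀ m n, f m ≠ g n := fun m n h => by
    have h0 := hf m (h ▸ hg n)
    rw [h, hgd] at h0
    exact (hd01 n).1.ne' h0
  have hfinj : Function.Injective f := fun m n h => hvinj (by rw [← hfv, ← hfv, h])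
  have hginj : Function.Injective g := fun m n h => hdinj (by rw [← hgd, ← hgd, h])
  have hseq := hv.interleave hd
  have hval : ∀ n, (if n % 2 = 0 then f (n / 2) else g (n / 2)).value =
      if n % 2 = 0 then v (n / 2) else d (n / 2) := fun n => by
    split_ifs
    · exact hfv _
    · exact hgd _
  simp only [← hval] at hseq
  refine ⟨fun n => if n % 2 = 0 then f (n / 2) else g (n / 2), ⟨⟨Set.Subset.antisymm ?_ ?_,
    hseq.isCEDyadicNat fun _ => CantorSpace.value_le_one _⟩, ?_⟩⟩
  · rintro _ ⟨n, rfl⟩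
    exact (isLeftCE_iff _).2 (hseq.isLeftCEReal n)
  · intro x hx
    by_cases hterm : x.IsNonterminating
    · have h : x.value ∈ Set.range v :=
        hvr ▸ ⟨x.value_nonneg, x.value_le_one, (isLeftCE_iff x).1 hx⟩
      obtain ⟨e, he⟩ := h
      refine ⟨2 * e, ?_⟩
      have : 2 * e / 2 = e := by omega
      simp only [Nat.mul_mod_right, if_true, this]
      exact (hf e).eq_of_value_eq hterm ((hfv e).trans he)
    · obtain ⟨hz, h0⟩ := Classical.not_imp.1 hterm
      -- The only expansion of `1` consists of ones, so a terminating `x` has value below `1` and is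
      -- reached through `d`.
      have h1 : x.value ≠ 1 := fun h => zero_ne_one (hz.unique
        ⟨0, fun m _ => CantorSpace.eq_one_of_value_eq_one h m⟩)
      have h : x.value ∈ Set.range d := hdr ▸ ⟨x.value_nonneg.lt_of_ne' h0,
        x.value_le_one.lt_of_ne h1, CantorSpace.isDyadicReal_of_eventuallyEq_zero hz⟩
      obtain ⟨e, he⟩ := h
      refine ⟨2 * e + 1, ?_⟩
      have h2 : (2 * e + 1) / 2 = e := by omega
      have h3 : ¬ (2 * e + 1) % 2 = 0 := by omega
      simp only [if_neg h3, h2]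
      exact (hg e).eq_of_value_eq hz ((hgd e).trans he)
  · intro m n h
    simp only at h
    split_ifs at h with hm hn hn
    · have := hfinj h
      omega
    · exact absurd h (hfg _ _)
    · exact absurd h.symm (hfg _ _)
    · have := hginj h
      omega

/-- The left-c.e. reals have a Friedberg numbering, both as elements of Cantor space and as real
numbers (so that two binary expansions of the same number are identified). -/
theorem mainTheorem8 :
    (∃ r : ℕ → CantorSpace, IsFriedbergNumbering {x | IsLeftCE x} r) ∧
    (∃ v : ℕ → ℝ, Set.range v = CantorSpace.value '' {x | IsLeftCE x} ∧
      Function.Injective v ∧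
      IsCEDyadicNat {p | p.1 ∈ dyadicRationals ∧ (p.1 : ℝ) < v p.2}) := by
  refine ⟨exists_isFriedbergNumbering, ?_⟩
  obtain ⟨v, hvinj, hv, hvr⟩ := exists_injective_enumeration_leftCEReals
  refine ⟨v, ?_, hvinj, hv.isCEDyadicNat fun e => ?_⟩
  · rw [hvr]
    ext u
    constructor
    · rintro ⟨h0, h1, hu⟩
      obtain ⟨x, -, rfl⟩ := CantorSpace.exists_isNonterminating h0 h1
      exact ⟨x, (isLeftCE_iff x).2 hu, rfl⟩
    · rintro ⟨x, hx, rfl⟩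
      exact ⟨x.value_nonneg, x.value_le_one, (isLeftCE_iff x).1 hx⟩
  · have h : v e ∈ Set.range v := ⟨e, rfl⟩
    rw [hvr] at h
    exact h.2.1
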